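/- Let $\kappa$ be an infinite cardinal with $2^{\kappa}<\aleph_\kappa$ and $\operatorname{cf}(\kappa)>\omega$. Let $D(2)$ be the two-point discrete space and let $$X=\Big(\bigoplus_{\xi<\kappa} D(2)^{\kappa}\Big)\oplus D(2)^{\aleph_\kappa}$$ be the topological sum of $\kappa$ copies of the Cantor cube $D(2)^{\kappa}$ and one copy of the Cantor cube $D(2)^{\aleph_\kappa}$. Then: 1. $X$ is locally compact and $T_4$ (normal and $T_1$); 2. $X$ has exactly $2^{\aleph_\kappa}$ open subsets and exactly $2^{\aleph_\kappa}$ points, i.e. $o(X)=2^{\aleph_\kappa}=|X|$; 3. $\aleph_\kappa\in\mathsf{C}^*(X)$: every collection $\mathcal U$ of non-empty open subsets of $X$ with $|\mathcal U|=\aleph_\kappa$ has a subcollection $\mathcal V\subseteq\mathcal U$ with $|\mathcal V|=\aleph_\kappa$ and $\bigcap\mathcal V\neq\emptyset$; 4. $\aleph_\kappa\notin\mathsf{WP}(X)$: it is not the case that for every indexed family $\{U_\alpha:\alpha<\aleph_\kappa\}$ of non-empty open subsets of $X$ (repetitions allowed) there is $J\subseteq\aleph_\kappa$ with $|J|=\aleph_\kappa$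 such that $U_\alpha\cap U_\beta\neq\emptyset$ for all $\alpha,\beta\in J$; 5. $\kappa\notin\mathsf{WP}^*(X)$: it is not the case that every collection $\mathcal U$ of non-empty open subsets of $X$ with $|\mathcal U|=\kappa$ has a subcollection $\mathcal V\subseteq\mathcal U$ with $|\mathcal V|=\kappa$ such that $U\cap V\neq\emptyset$ for all $U,V\in\mathcal V$. In particular, a locally compact $T_4$ space with properties 2–5 exists. -/

import Mathlib

open Cardinal

universe u

/-- The Cantor cube `D(2)^lam` of weight `lam`: the product of `lam` copies of the two-point
discrete space, with the product topology. -/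
abbrev CantorCube (lam : Cardinal.{u}) : Type u :=
  lam.out → Bool

/-- The topological sum of `kap` copies of the Cantor cube `D(2)^kap` and of one copy of the
Cantor cube `D(2)^(ℵ_kap)`. -/
abbrev CubeSum (kap : Cardinal.{u}) : Type u :=
  (Σ _ : kap.out, CantorCube kap) ⊕ CantorCube (ℵ_ kap.ord)

/-- The number `o(X)` of open subsets of `X`. -/
def openCard (X : Type u) [TopologicalSpace X] : Cardinal.{u} :=
  #{U : Set X // IsOpen U}

/-- A collection of sets is linked if any two of its members meet. -/
def IsLinked {X : Type u} (𝒱 : Set (Set X)) : Prop :=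
  ∀ U ∈ 𝒱, ∀ V ∈ 𝒱, (U ∩ V).Nonempty

/-- `kap` is a weak precaliber for `X`: every indexed family (repetitions allowed) of `kap`
non-empty open sets has a linked subfamily indexed by `kap` many indices. -/
def IsWeakPrecaliber (X : Type u) [TopologicalSpace X] (kap : Cardinal.{u}) : Prop :=
  ∀ U : kap.out → Set X, (∀ i, IsOpen (U i) ∧ (U i).Nonempty) →
    ∃ J : Set kap.out, #J = kap ∧ IsLinked (U '' J)

/-- `kap` is a weak precaliber* for `X`: every collection of exactly `kap` (distinct) non-empty
open sets has a linked subcollection of cardinality `kap`. -/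
def IsWeakPrecaliberStar (X : Type u) [TopologicalSpace X] (kap : Cardinal.{u}) : Prop :=
  ∀ 𝒰 : Set (Set X), (∀ U ∈ 𝒰, IsOpen U ∧ U.Nonempty) → #𝒰 = kap →
    ∃ 𝒱 ⊆ 𝒰, #𝒱 = kap ∧ IsLinked 𝒱

/-- `kap` is a caliber* for `X`: every collection of exactly `kap` (distinct) non-empty open sets
has a subcollection of cardinality `kap` with non-empty intersection. -/
def IsCaliberStar (X : Type u) [TopologicalSpace X] (kap : Cardinal.{u}) : Prop :=
  ∀ 𝒰 : Set (Set X), (∀ U ∈ 𝒰, IsOpen U ∧ U.Nonempty) → #𝒰 = kap →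
    ∃ 𝒱 ⊆ 𝒰, #𝒱 = kap ∧ (⋂₀ 𝒱).Nonempty

/-- The infinite cardinals that are weak precalibers for `X`. -/
def WP (X : Type u) [TopologicalSpace X] : Set Cardinal.{u} :=
  {kap | ℵ₀ ≤ kap ∧ IsWeakPrecaliber X kap}

/-- The infinite cardinals that are weak precalibers* for `X`. -/
def WPStar (X : Type u) [TopologicalSpace X] : Set Cardinal.{u} :=
  {kap | ℵ₀ ≤ kap ∧ IsWeakPrecaliberStar X kap}

/-- The infinite cardinals that are calibers* for `X`. -/
def CStar (X : Type u) [TopologicalSpace X] : Set Cardinal.{u} :=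
  {kap | ℵ₀ ≤ kap ∧ IsCaliberStar X kap}

/-! Write λ = ℵ_κ, a singular cardinal since κ < 2^κ < λ. The small cubes are pairwise disjoint and
open: as a collection they refute WP* at κ, and repeating the t-th one c t < λ times, with the c t
cofinal in λ, refutes WP at λ. Distinctness blocks such repetition: open sets missing the big cube
are determined by their traces on the small part, which has at most 2^κ open sets. So λ many members
meet the big cube, and each contains a basic cylinder there.

It remains to find λ many finite partial functions with a common extension
(`exists_common_extension`). As cf λ = cf κ > ω, the domains may be assumed of size at most n;
induct on n. If some point lies in λ many domains, fix a value there and delete it. If the degrees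
of points are bounded below λ, take λ many disjoint domains. Otherwise choose at most κ points with
degrees cofinal in λ, and use a finite colouring to find a set of them that λ many domains meet in
exactly one point; delete that point. -/

/-! ### Colourings of finite set mappings -/

/-- A finite set mapping of bounded order has a finite colouring, on finite sets. -/
theorem exists_coloring_on_finset {V : Type*} (s : V → Finset V) (n : ℕ)
    (hs : ∀ x, (s x).card ≤ n) (W : Finset V) :
    ∃ c : V → Fin (2 * n + 1), ∀ x ∈ W, ∀ y ∈ W, y ∈ s x → y ≠ x → c x ≠ c y := by
  classical
  induction W using Finset.strongInduction with
  | H W ih =>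
  rcases W.eq_empty_or_nonempty with rfl | hW
  · exact ⟨fun _ => 0, by simp⟩
  -- Double counting: the average in-degree on `W` is at most `n`. Such an `x` has at most `2 * n`
  -- neighbours, so one colour stays free for it.
  obtain ⟨x, hx, hdeg⟩ : ∃ x ∈ W, (W.filter fun y => x ∈ s y).card ≤ n := by
    by_contra! h
    have h1 : ∑ x ∈ W, (W.filter fun y => x ∈ s y).card
        = ∑ y ∈ W, (W.filter fun x => x ∈ s y).card :=
      Finset.sum_card_bipartiteAbove_eq_sum_card_bipartiteBelow fun x y => x ∈ s y
    have h2 : ∑ y ∈ W, (W.filter fun x => x ∈ s y).card ≤ ∑ _y ∈ W, n :=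
      Finset.sum_le_sum fun y _ =>
        (Finset.card_le_card fun z hz => (Finset.mem_filter.1 hz).2).trans (hs y)
    have h3 : ∑ _y ∈ W, n < ∑ x ∈ W, (W.filter fun y => x ∈ s y).card :=
      Finset.sum_lt_sum_of_nonempty hW fun y hy => h y hy
    omega
  obtain ⟨c, hc⟩ := ih (W.erase x) (Finset.erase_ssubset hx)
  obtain ⟨q, hq⟩ : ∃ q, q ∉ (s x ∪ W.filter fun y => x ∈ s y).image c := by
    by_contra! h
    have h1 : (Finset.univ : Finset (Fin (2 * n + 1))).card
        ≤ ((s x ∪ W.filter fun y => x ∈ s y).image c).card :=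
      Finset.card_le_card fun q _ => h q
    have h2 := h1.trans (Finset.card_image_le.trans (Finset.card_union_le _ _))
    have h3 := hs x
    rw [Finset.card_univ, Fintype.card_fin] at h2
    omega
  simp only [Finset.mem_image, Finset.mem_union, Finset.mem_filter, not_exists, not_and] at hq
  refine ⟨Function.update c x q, fun a ha b hb hab hne => ?_⟩
  by_cases hax : a = x
  · subst hax
    rw [Function.update_self, Function.update_of_ne hne]
    exact fun h => hq b (Or.inl hab) h.symm
  · rw [Function.update_of_ne hax]
    by_cases hbx : b = x
    · subst hbx
      rw [Function.update_self]
      exact hq a (Or.inr ⟨ha, hab⟩)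
    · rw [Function.update_of_ne hbx]
      exact hc a (Finset.mem_erase.2 ⟨hax, ha⟩) b (Finset.mem_erase.2 ⟨hbx, hb⟩) hab hne

/-- A set mapping into finite sets of size at most `n` has a colouring with `2 * n + 1` colours
whose colour classes are free. -/
theorem exists_coloring_of_card_le {V : Type*} (s : V → Finset V) (n : ℕ)
    (hs : ∀ x, (s x).card ≤ n) :
    ∃ c : V → Fin (2 * n + 1), ∀ x, ∀ y ∈ s x, y ≠ x → c x ≠ c y := by
  classical
  -- Compactness of the space of colourings reduces the claim to finitely many `x`.
  have key : (⋂ x, {c : V → Fin (2 * n + 1) | ∀ y ∈ s x, y ≠ x → c x ≠ c y}).Nonempty := by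
    refine CompactSpace.iInter_nonempty (fun x => ?_) fun W => ?_
    · have : {c : V → Fin (2 * n + 1) | ∀ y ∈ s x, y ≠ x → c x ≠ c y}
          = ⋂ y, ⋂ (_ : y ∈ s x), ⋂ (_ : y ≠ x),
            (fun c : V → Fin (2 * n + 1) => (c x, c y)) ⁻¹' {q | q.1 ≠ q.2} := by
        ext c; simp
      rw [this]
      exact isClosed_iInter fun y => isClosed_iInter fun _ => isClosed_iInter fun _ =>
        (isClosed_discrete _).preimage ((continuous_apply x).prodMk (continuous_apply y))
    · obtain ⟨c, hc⟩ := exists_coloring_on_finset s n hs (W ∪ W.biUnion s)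
      refine ⟨c, Set.mem_iInter₂.2 fun x hx y hy hne => ?_⟩
      exact hc x (Finset.mem_union_left _ hx) y
        (Finset.mem_union_right _ (Finset.mem_biUnion.2 ⟨x, hx, hy⟩)) hy hne
  obtain ⟨c, hc⟩ := key
  exact ⟨c, fun x => Set.mem_iInter.1 hc x⟩

/-! ### Common extensions of finite partial functions -/

/-- A symmetric relation on an infinite set whose degrees are bounded below the cardinality of the
set has an independent set of full cardinality. -/
theorem exists_independent_set {ι : Type u} (R : ι → ι → Prop) (hR : ∀ i j, R i j → R j i)
    (hι : ℵ₀ ≤ #ι) {ν : Cardinal.{u}} (hν : ν < #ι) (hdeg : ∀ i, #{j | R i j} ≤ ν) :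
    ∃ J : Set ι, #J = #ι ∧ J.Pairwise fun i j => ¬ R i j := by
  obtain ⟨J, hJ⟩ := zorn_subset {J : Set ι | J.Pairwise fun i j => ¬ R i j}
    fun C hC hch => ⟨⋃₀ C, (Set.pairwise_sUnion hch.directedOn).2 fun a ha => hC ha,
      fun a ha => Set.subset_sUnion_of_mem ha⟩
  refine ⟨J, (mk_set_le J).antisymm ?_, hJ.prop⟩
  by_contra! hlt
  -- A maximal independent set and its neighbours exhaust `ι`.
  have hcov : (Set.univ : Set ι) ⊆ J ∪ ⋃ i ∈ J, {j | R i j} := by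
    intro j _
    by_contra hj
    simp only [Set.mem_union, Set.mem_iUnion, not_or, not_exists] at hj
    have h1 : insert j J ∈ {J : Set ι | J.Pairwise fun i j => ¬ R i j} := by
      refine hJ.prop.insert fun b hb _ => ⟨fun h => hj.2 b hb (hR _ _ h), fun h => hj.2 b hb h⟩
    exact hj.1 (hJ.le_of_ge h1 (Set.subset_insert j J) (Set.mem_insert j J))
  have h2 : #(⋃ i ∈ J, {j | R i j} : Set ι) < #ι :=
    ((mk_biUnion_le _ _).trans (mul_le_mul' le_rfl (ciSup_le' fun i => hdeg i))).trans_lt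
      (mul_lt_of_lt hι hlt hν)
  have h3 := (mk_le_mk_of_subset hcov).trans (mk_union_le _ _)
  rw [mk_univ] at h3
  exact h3.not_gt (add_lt_of_lt hι hlt h2)

/-- Uncountably many finite partial functions such that every point belongs to few domains: full
cardinality many of them have a common extension. -/
theorem exists_common_extension_of_bounded {D ι : Type u} (F : ι → Finset D) (p : ι → D → Bool)
    (hι : ℵ₀ < #ι) {ν : Cardinal.{u}} (hν : ν < #ι) (hdeg : ∀ x, #{i | x ∈ F i} ≤ ν) :
    ∃ J : Set ι, #J = #ι ∧ ∃ g : D → Bool, ∀ i ∈ J, ∀ x ∈ F i, g x = p i x := by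
  classical
  obtain ⟨J, hJ, hJd⟩ := exists_independent_set (fun i j => ∃ x ∈ F i, x ∈ F j)
    (fun i j ⟨x, hi, hj⟩ => ⟨x, hj, hi⟩) hι.le (mul_lt_of_lt hι.le hι hν) fun i => by
      have : {j | ∃ x ∈ F i, x ∈ F j} = ⋃ x ∈ (F i : Set D), {j | x ∈ F j} := by ext; simp
      rw [this]
      refine (mk_biUnion_le _ _).trans (mul_le_mul' ?_ (ciSup_le' fun x => hdeg x))
      exact (F i).countable_toSet.le_aleph0
  refine ⟨J, hJ, fun x => if h : ∃ i ∈ J, x ∈ F i then p h.choose x else false,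
    fun i hi x hx => ?_⟩
  have h : ∃ i ∈ J, x ∈ F i := ⟨i, hi, hx⟩
  have : h.choose = i := by
    by_contra hne
    exact hJd h.choose_spec.1 hi hne ⟨x, h.choose_spec.2, hx⟩
  simp only [dif_pos h, this]

/-- If the number of domains that contain a point is unbounded below `lam`, then `lam` many of the
domains meet some set `I` in exactly one point, with prescribed values there. -/
theorem exists_transversal_of_unbounded {D ι T : Type u} (F : ι → Finset D) (p : ι → D → Bool)
    {lam : Cardinal.{u}} (hT : ℵ₀ ≤ #T) (hTlam : #T < lam) (c : T → Cardinal.{u})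
    (hclam : ∀ t, c t < lam) (hc : ∀ ν < lam, ∃ t, ν ≤ c t) (hι : #ι = lam) {n : ℕ}
    (hF : ∀ i, (F i).card ≤ n) (hlt : ∀ x, #{i | x ∈ F i} < lam)
    (hunb : ∀ ν < lam, ∃ x, ν < #{i | x ∈ F i}) :
    ∃ (I : Set D) (v : D → Bool) (S : Set ι), #S = lam ∧ (∀ i ∈ S, ∃ x ∈ F i, x ∈ I) ∧
      ∀ i ∈ S, ∀ x ∈ F i, x ∈ I → v x = p i x := by
  classical
  set a : D → Cardinal.{u} := fun x => #{i | x ∈ F i}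
  -- Minimal degree makes `y t` insensitive to `t`: below, `r` may pick another index for the same
  -- point, and minimality still bounds `a z` by the threshold of that index.
  have hmin : ∀ t, ∃ x, max (c t) #T < a x ∧ ∀ z, max (c t) #T < a z → a x ≤ a z := by
    intro t
    obtain ⟨x, hx, hmin⟩ := (InvImage.wf a Cardinal.lt_wf).has_min {x | max (c t) #T < a x}
      (hunb _ (max_lt (hclam t) hTlam))
    exact ⟨x, hx, fun z hz => not_lt.1 (hmin z hz)⟩
  choose y hy hymin using hmin
  set I : Set D := Set.range y
  choose r hr using fun x : I => x.2
  have hIT : #I ≤ #T := mk_range_le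
  have hkey : #(Finset I × Bool) ≤ #T := by
    rw [mk_prod, lift_uzero, mk_bool, lift_ofNat]
    refine mul_le_of_le hT ?_ ((natCast_lt_aleph0 (n := 2)).le.trans hT)
    rcases finite_or_infinite I with h | h
    · exact (Cardinal.lt_aleph0_of_finite (Finset I)).le.trans hT
    · rwa [mk_finset_of_infinite]
  -- Thin the domains through `x` so that their trace on `I` and their value at `x` are constant.
  -- Pigeonholing at a successor, which is regular and exceeds `#T`, keeps more than `c (r x)` of
  -- them.
  have hpiece : ∀ x : I, ∃ (k : Finset I × Bool) (B : Set ι), B ⊆ {i | x.1 ∈ F i} ∧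
      max (c (r x)) #T < #B ∧ ∀ i ∈ B, ((F i).subtype (· ∈ I), p i x) = k := by
    intro x
    have hreg := isRegular_succ (hT.trans (le_max_right (c (r x)) #T))
    obtain ⟨k, B, hB, hcard, hval⟩ := infinite_pigeonhole_set
      (s := {i | x.1 ∈ F i}) (fun i => ((F i.1).subtype (· ∈ I), p i.1 x))
      (Order.succ (max (c (r x)) #T)) (Order.succ_le_of_lt (by
        have := hy (r x); rwa [hr x] at this)) hreg.aleph0_le
      (by rw [hreg.cof_ord]; exact hkey.trans_lt (Order.lt_succ_of_le (le_max_right _ _)))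
    exact ⟨k, B, hB, Order.succ_le_iff.1 hcard, fun i hi => hval hi⟩
  choose k B hB hBcard hBval using hpiece
  have hBne : ∀ x, (B x).Nonempty := fun x => by
    rw [Set.nonempty_iff_ne_empty]
    intro h
    have := hBcard x
    rw [h, mk_eq_zero (∅ : Set ι)] at this
    exact (not_lt_bot this)
  -- The traces form a set mapping on `I`; within one colour class, a domain from `B x` meets only
  -- `x`.
  obtain ⟨col, hcol⟩ := exists_coloring_of_card_le (fun x => (k x).1) n fun x => by
    obtain ⟨i, hi⟩ := hBne x
    rw [← hBval x i hi, Finset.card_subtype]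
    exact (Finset.card_filter_le _ _).trans (hF i)
  -- The largest colour class has size `lam`: otherwise some `B x` would exceed it, yet `B x` lies
  -- in the class of `col x`.
  obtain ⟨q, hq⟩ := Finite.exists_max fun q => #(⋃ x ∈ {x | col x = q}, B x : Set ι)
  refine ⟨{x | ∃ h : x ∈ I, col ⟨x, h⟩ = q}, fun x => if h : x ∈ I then (k ⟨x, h⟩).2 else false,
    ⋃ x ∈ {x | col x = q}, B x, ?_, ?_, ?_⟩
  · refine ((mk_set_le _).trans hι.le).antisymm ?_
    by_contra! hsmall
    obtain ⟨z, hz⟩ := hunb _ hsmall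
    obtain ⟨t, ht⟩ := hc _ (hlt z)
    set x : I := ⟨y t, t, rfl⟩
    have h1 : a z ≤ max (c (r x)) #T := by
      by_contra! h
      have h2 := hymin _ z h
      rw [hr x] at h2
      exact ((ht.trans (le_max_left _ _)).trans_lt (hy t)).not_ge h2
    have h2 : #(B x) ≤ #(⋃ x' ∈ {x' | col x' = col x}, B x' : Set ι) :=
      mk_le_mk_of_subset (Set.subset_biUnion_of_mem (u := B) (Set.mem_ofPred_eq ▸ rfl))
    exact ((hz.trans_le h1).trans (hBcard x)).not_ge (h2.trans (hq (col x)))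
  · intro i hi
    obtain ⟨x, hx, hi⟩ := Set.mem_iUnion₂.1 hi
    exact ⟨x, hB x hi, x.2, hx⟩
  · rintro i hi z hz ⟨hzI, hzq⟩
    obtain ⟨x, hx, hi⟩ := Set.mem_iUnion₂.1 hi
    have hzx : (⟨z, hzI⟩ : I) = x := by
      by_contra hne
      refine hcol x ⟨z, hzI⟩ ?_ hne (Eq.trans hx hzq.symm)
      rw [← hBval x i hi]
      simpa using hz
    subst hzx
    simp only [dif_pos hzI, ← hBval _ i hi]

/-- Extending a common extension by prescribed values on a set that meets every domain. -/
theorem exists_common_extension_of_transversal {D ι : Type u} (F : ι → Finset D)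
    (p : ι → D → Bool) {lam : Cardinal.{u}} {n : ℕ} (hF : ∀ i, (F i).card ≤ n + 1)
    (ih : ∀ (ι : Type u) (F : ι → Finset D) (p : ι → D → Bool), #ι = lam →
      (∀ i, (F i).card ≤ n) →
      ∃ J : Set ι, #J = lam ∧ ∃ g : D → Bool, ∀ i ∈ J, ∀ x ∈ F i, g x = p i x)
    (I : Set D) (v : D → Bool) (S : Set ι) (hS : #S = lam) (hSI : ∀ i ∈ S, ∃ x ∈ F i, x ∈ I)
    (hv : ∀ i ∈ S, ∀ x ∈ F i, x ∈ I → v x = p i x) :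
    ∃ J : Set ι, #J = lam ∧ ∃ g : D → Bool, ∀ i ∈ J, ∀ x ∈ F i, g x = p i x := by
  classical
  -- Removing `I` costs each domain at least one point.
  obtain ⟨J, hJ, g, hg⟩ := ih S (fun i => (F i).filter (· ∉ I)) (fun i => p i) hS fun i => by
    obtain ⟨x, hx, hxI⟩ := hSI i i.2
    have : (F i).filter (· ∉ I) ⊂ F i :=
      Finset.filter_ssubset.2 ⟨x, hx, by simpa using hxI⟩
    have := (Finset.card_lt_card this).trans_le (hF i)
    omega
  refine ⟨Subtype.val '' J, by rw [mk_image_eq Subtype.val_injective, hJ],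
    fun x => if x ∈ I then v x else g x, ?_⟩
  rintro _ ⟨i, hi, rfl⟩ x hx
  by_cases hxI : x ∈ I
  · simp only [if_pos hxI, hv i i.2 x hx hxI]
  · simp only [if_neg hxI]
    exact hg i hi x (Finset.mem_filter.2 ⟨hx, hxI⟩)

/-- Among `lam` many partial functions with domains of bounded finite size, where `lam` is
singular, there are `lam` many with a common extension. -/
theorem exists_common_extension_of_card_le {D T : Type u} {lam : Cardinal.{u}} (hT : ℵ₀ ≤ #T)
    (hTlam : #T < lam) (c : T → Cardinal.{u}) (hclam : ∀ t, c t < lam)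
    (hc : ∀ ν < lam, ∃ t, ν ≤ c t) (n : ℕ) :
    ∀ (ι : Type u) (F : ι → Finset D) (p : ι → D → Bool), #ι = lam → (∀ i, (F i).card ≤ n) →
      ∃ J : Set ι, #J = lam ∧ ∃ g : D → Bool, ∀ i ∈ J, ∀ x ∈ F i, g x = p i x := by
  classical
  induction n with
  | zero =>
    intro ι F p hι hF
    refine ⟨Set.univ, by rw [mk_univ, hι], fun _ => false, fun i _ x hx => ?_⟩
    rw [Finset.card_eq_zero.1 (Nat.le_zero.1 (hF i))] at hx
    simp at hx
  | succ n ih =>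
    intro ι F p hι hF
    have hlam : ℵ₀ ≤ lam := hT.trans hTlam.le
    by_cases hA : ∃ x, #{i | x ∈ F i} = lam
    · obtain ⟨x, hx⟩ := hA
      obtain ⟨v, hv⟩ : ∃ v, #{i | x ∈ F i ∧ p i x = v} = lam := by
        by_contra! h
        have hle : ∀ v, #{i | x ∈ F i ∧ p i x = v} < lam := fun v =>
          ((mk_set_le _).trans hι.le).lt_of_ne (h v)
        have hsub : {i | x ∈ F i} ⊆
            {i | x ∈ F i ∧ p i x = true} ∪ {i | x ∈ F i ∧ p i x = false} := by
          intro i hi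
          cases hp : p i x
          · exact Or.inr ⟨hi, hp⟩
          · exact Or.inl ⟨hi, hp⟩
        exact (hx.ge.trans ((mk_le_mk_of_subset hsub).trans (mk_union_le _ _))).not_gt
          (add_lt_of_lt hlam (hle true) (hle false))
      refine exists_common_extension_of_transversal F p hF ih {x} (fun _ => v) _ hv
        (fun i hi => ⟨x, hi.1, rfl⟩) ?_
      rintro i hi _ _ rfl
      exact hi.2.symm
    · have hlt : ∀ x, #{i | x ∈ F i} < lam := fun x =>
        ((mk_set_le _).trans hι.le).lt_of_ne fun h => hA ⟨x, h⟩
      by_cases hunb : ∀ ν < lam, ∃ x, ν < #{i | x ∈ F i}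
      · obtain ⟨I, v, S, hS, hSI, hv⟩ :=
          exists_transversal_of_unbounded F p hT hTlam c hclam hc hι hF hlt hunb
        exact exists_common_extension_of_transversal F p hF ih I v S hS hSI hv
      · push Not at hunb
        obtain ⟨ν, hν, hdeg⟩ := hunb
        rw [← hι]
        exact exists_common_extension_of_bounded F p (hT.trans_lt (hTlam.trans_eq hι.symm))
          (hν.trans_eq hι.symm) hdeg

/-- Among `lam` many finite partial functions, where `lam` is singular of uncountable cofinality,
there are `lam` many with a common extension. -/
theorem exists_common_extension {D ι T : Type u} {lam : Cardinal.{u}} (hT : ℵ₀ ≤ #T)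
    (hTlam : #T < lam) (c : T → Cardinal.{u}) (hclam : ∀ t, c t < lam)
    (hc : ∀ ν < lam, ∃ t, ν ≤ c t) (hcof : ℵ₀ < lam.ord.cof)
    (F : ι → Finset D) (p : ι → D → Bool) (hι : #ι = lam) :
    ∃ J : Set ι, #J = lam ∧ ∃ g : D → Bool, ∀ i ∈ J, ∀ x ∈ F i, g x = p i x := by
  obtain ⟨n, hn⟩ := infinite_pigeonhole (fun i => ULift.up.{u} (F i).card)
    (by rw [hι]; exact hT.trans hTlam.le) (by rw [hι, mk_uLift, mk_nat, lift_aleph0]; exact hcof)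
  obtain ⟨J, hJ, g, hg⟩ := exists_common_extension_of_card_le (D := D) hT hTlam c hclam hc n.down
    _ (fun i : ((fun i => ULift.up.{u} (F i).card) ⁻¹' {n} : Set ι) => F i) (fun i => p i)
    (hn.trans hι) fun i => (congrArg ULift.down i.2).le
  refine ⟨Subtype.val '' J, by rw [mk_image_eq Subtype.val_injective, hJ], g, ?_⟩
  rintro _ ⟨i, hi, rfl⟩
  exact hg i hi

/-! ### Topological sums -/

/-- A topological sum of normal spaces is normal. -/
theorem normalSpace_sigma {ι : Type*} {X : ι → Type*} [∀ i, TopologicalSpace (X i)]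
    [∀ i, NormalSpace (X i)] : NormalSpace (Σ i, X i) where
  normal s t hs ht hst := by
    choose U V hU hV hsU htV hUV using fun i => normal_separation
      (hs.preimage (continuous_sigmaMk (σ := X) (i := i)))
      (ht.preimage (continuous_sigmaMk (σ := X) (i := i))) (hst.preimage (Sigma.mk i))
    exact ⟨{x | x.2 ∈ U x.1}, {x | x.2 ∈ V x.1}, isOpen_sigma_iff.2 hU, isOpen_sigma_iff.2 hV,
      fun x hx => hsU x.1 hx, fun x hx => htV x.1 hx,
      Set.disjoint_left.2 fun x hx hx' => Set.disjoint_left.1 (hUV x.1) hx hx'⟩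

/-- The topological sum of two normal spaces is normal. -/
theorem normalSpace_sum {X Y : Type*} [TopologicalSpace X] [TopologicalSpace Y]
    [NormalSpace X] [NormalSpace Y] : NormalSpace (X ⊕ Y) where
  normal s t hs ht hst := by
    obtain ⟨U, V, hU, hV, hsU, htV, hUV⟩ := normal_separation
      (hs.preimage (continuous_inl (X := X) (Y := Y)))
      (ht.preimage continuous_inl) (hst.preimage Sum.inl)
    obtain ⟨U', V', hU', hV', hsU', htV', hUV'⟩ := normal_separation
      (hs.preimage (continuous_inr (X := X) (Y := Y)))
      (ht.preimage continuous_inr) (hst.preimage Sum.inr)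
    refine ⟨{x | Sum.elim (· ∈ U) (· ∈ U') x}, {x | Sum.elim (· ∈ V) (· ∈ V') x},
      isOpen_sum_iff.2 ⟨hU, hU'⟩, isOpen_sum_iff.2 ⟨hV, hV'⟩, ?_, ?_, ?_⟩
    · rintro (x | x) hx
      exacts [hsU hx, hsU' hx]
    · rintro (x | x) hx
      exacts [htV hx, htV' hx]
    · refine Set.disjoint_left.2 ?_
      rintro (x | x) hx hx'
      exacts [Set.disjoint_left.1 hUV hx hx', Set.disjoint_left.1 hUV' hx hx']

theorem weaklyLocallyCompactSpace_sigma {ι : Type*} {X : ι → Type*}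
    [∀ i, TopologicalSpace (X i)] [∀ i, CompactSpace (X i)] :
    WeaklyLocallyCompactSpace (Σ i, X i) where
  exists_compact_mem_nhds x := ⟨Set.range (Sigma.mk x.1), isCompact_range continuous_sigmaMk,
    isOpen_range_sigmaMk.mem_nhds ⟨x.2, rfl⟩⟩

theorem weaklyLocallyCompactSpace_sum {X Y : Type*} [TopologicalSpace X] [TopologicalSpace Y]
    [WeaklyLocallyCompactSpace X] [WeaklyLocallyCompactSpace Y] :
    WeaklyLocallyCompactSpace (X ⊕ Y) where
  exists_compact_mem_nhds := by
    rintro (x | y)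
    · obtain ⟨K, hK, hx⟩ := exists_compact_mem_nhds x
      exact ⟨Sum.inl '' K, hK.image continuous_inl,
        Topology.IsOpenEmbedding.inl.isOpenMap.image_mem_nhds hx⟩
    · obtain ⟨K, hK, hy⟩ := exists_compact_mem_nhds y
      exact ⟨Sum.inr '' K, hK.image continuous_inr,
        Topology.IsOpenEmbedding.inr.isOpenMap.image_mem_nhds hy⟩

/-! ### Counting open sets and points -/

/-- An open subset of a power of the two-point discrete space contains, around each of its points,
all the points that agree with it on some finite set of coordinates. -/
theorem exists_finset_of_isOpen_cube {D : Type*} {U : Set (D → Bool)} (hU : IsOpen U)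
    {f : D → Bool} (hf : f ∈ U) :
    ∃ F : Finset D, ∀ g : D → Bool, (∀ x ∈ F, g x = f x) → g ∈ U := by
  obtain ⟨F, u, hu, hsub⟩ := isOpen_pi_iff.1 hU f hf
  exact ⟨F, fun g hg => hsub fun x hx => by rw [hg x hx]; exact (hu x hx).2⟩

/-- An open set is determined by the basic cylinders it contains, and there are at most `#D` of
these. -/
theorem openCard_cube_le (D : Type u) [Infinite D] : openCard (D → Bool) ≤ 2 ^ #D := by
  classical
  have hcard : #(Set (Finset D × Finset D)) = 2 ^ #D := by
    rw [mk_set, mk_prod, lift_id, mk_finset_of_infinite, mul_eq_self (aleph0_le_mk D)]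
  rw [← hcard]
  set cyl : Finset D × Finset D → Set (D → Bool) :=
    fun q => {g | (∀ x ∈ q.1, g x = true) ∧ ∀ x ∈ q.2, g x = false}
  refine mk_le_of_injective
    (f := fun U : {U : Set (D → Bool) // IsOpen U} => {q | cyl q ⊆ U.1}) ?_
  have hsub : ∀ U V : {U : Set (D → Bool) // IsOpen U},
      {q | cyl q ⊆ U.1} ⊆ {q | cyl q ⊆ V.1} → U.1 ⊆ V.1 := by
    intro U V h f hf
    obtain ⟨F, hF⟩ := exists_finset_of_isOpen_cube U.2 hf
    have hmem : (F.filter (f · = true), F.filter (f · = false)) ∈ {q | cyl q ⊆ U.1} := by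
      rintro g ⟨h1, h2⟩
      refine hF g fun x hx => ?_
      cases hfx : f x
      · exact h2 x (Finset.mem_filter.2 ⟨hx, hfx⟩)
      · exact h1 x (Finset.mem_filter.2 ⟨hx, hfx⟩)
    exact (h hmem : cyl _ ⊆ V.1)
      ⟨fun x hx => (Finset.mem_filter.1 hx).2, fun x hx => (Finset.mem_filter.1 hx).2⟩
  intro U V h
  exact Subtype.ext ((hsub U V (Eq.subset h)).antisymm (hsub V U (Eq.subset h.symm)))

theorem openCard_sum_le (X Y : Type u) [TopologicalSpace X] [TopologicalSpace Y] :
    openCard (X ⊕ Y) ≤ openCard X * openCard Y := by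
  unfold openCard
  rw [mul_def]
  refine mk_le_of_injective (f := fun U : {U : Set (X ⊕ Y) // IsOpen U} =>
    ((⟨_, (isOpen_sum_iff.1 U.2).1⟩, ⟨_, (isOpen_sum_iff.1 U.2).2⟩) :
      {U : Set X // IsOpen U} × {U : Set Y // IsOpen U})) fun U V h => Subtype.ext ?_
  obtain ⟨h1, h2⟩ := Prod.mk.inj h
  ext (x | y)
  · exact Set.ext_iff.1 (congrArg Subtype.val h1) x
  · exact Set.ext_iff.1 (congrArg Subtype.val h2) y

theorem openCard_sigma_const_le (ι X : Type u) [TopologicalSpace X] :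
    openCard (Σ _ : ι, X) ≤ openCard X ^ #ι := by
  unfold openCard
  rw [power_def]
  refine mk_le_of_injective (f := fun (U : {U : Set (Σ _ : ι, X) // IsOpen U}) (i : ι) =>
    (⟨_, isOpen_sigma_iff.1 U.2 i⟩ : {U : Set X // IsOpen U})) fun U V h => Subtype.ext ?_
  ext ⟨i, x⟩
  exact Set.ext_iff.1 (congrArg Subtype.val (congrFun h i)) x

theorem mk_le_openCard (X : Type u) [TopologicalSpace X] [T1Space X] : #X ≤ openCard X :=
  mk_le_of_injective (f := fun x : X => (⟨{x}ᶜ, isOpen_compl_singleton⟩ : {U : Set X // IsOpen U}))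
    fun _ _ h => Set.singleton_injective (compl_injective (congrArg Subtype.val h))

theorem mk_cantorCube (lam : Cardinal.{u}) : #(CantorCube lam) = 2 ^ lam := by simp

theorem openCard_cantorCube_le {lam : Cardinal.{u}} (h : ℵ₀ ≤ lam) :
    openCard (CantorCube lam) ≤ 2 ^ lam := by
  have : Infinite lam.out := infinite_iff.2 (by rwa [mk_out])
  simpa using openCard_cube_le lam.out

theorem openCard_sigma_cantorCube_le {kap : Cardinal.{u}} (h : ℵ₀ ≤ kap) :
    openCard (Σ _ : kap.out, CantorCube kap) ≤ 2 ^ kap := by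
  refine (openCard_sigma_const_le _ _).trans
    ((power_le_power_right (openCard_cantorCube_le h)).trans ?_)
  rw [mk_out, ← power_mul, mul_eq_self h]

theorem mk_cubeSum (kap : Cardinal.{u}) :
    #(CubeSum kap) = 2 ^ ℵ_ kap.ord := by
  have hlam := aleph0_le_aleph kap.ord
  have hle := le_aleph_ord kap
  rw [mk_sum, lift_id, lift_id, mk_cantorCube, mk_sigma, sum_const', mk_cantorCube, mk_out]
  refine add_eq_right (hlam.trans (cantor _).le) ?_
  exact mul_le_of_le (hlam.trans (cantor _).le) (hle.trans (cantor _).le)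
    (power_le_power_left two_ne_zero hle)

theorem t4Space_cubeSum (kap : Cardinal.{u}) : T4Space (CubeSum kap) := by
  have : NormalSpace (Σ _ : kap.out, CantorCube kap) := normalSpace_sigma
  have : NormalSpace (CubeSum kap) := normalSpace_sum
  exact { }

theorem openCard_cubeSum {kap : Cardinal.{u}} (h : ℵ₀ ≤ kap) :
    openCard (CubeSum kap) = 2 ^ ℵ_ kap.ord := by
  have hlam := aleph0_le_aleph kap.ord
  refine le_antisymm ?_ ((mk_cubeSum kap).ge.trans (mk_le_openCard _))
  refine (openCard_sum_le _ _).trans (mul_le_of_le (hlam.trans (cantor _).le) ?_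
    (openCard_cantorCube_le hlam))
  exact (openCard_sigma_cantorCube_le h).trans (power_le_power_left two_ne_zero (le_aleph_ord kap))

theorem locallyCompactSpace_cubeSum (kap : Cardinal.{u}) : LocallyCompactSpace (CubeSum kap) := by
  have : WeaklyLocallyCompactSpace (Σ _ : kap.out, CantorCube kap) :=
    weaklyLocallyCompactSpace_sigma
  have : WeaklyLocallyCompactSpace (CubeSum kap) := weaklyLocallyCompactSpace_sum
  infer_instance

/-! ### Calibers and precalibers of the sum -/

/-- A family of `kap` cardinals cofinal below `ℵ_ kap`. -/
theorem exists_cofinal_cardinals {kap : Cardinal.{u}} (h : ℵ₀ ≤ kap) :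
    ∃ c : kap.out → Cardinal.{u}, (∀ t, c t < ℵ_ kap.ord) ∧ ∀ ν < ℵ_ kap.ord, ∃ t, ν < c t := by
  obtain ⟨e⟩ : Nonempty (kap.out ≃ kap.ord.ToType) := Cardinal.eq.1 (by simp)
  refine ⟨fun t => ℵ_ (Ordinal.ToType.mk.symm (e t)).1, fun t =>
    aleph_lt_aleph.2 (Ordinal.ToType.mk.symm (e t)).2, fun ν hν => ?_⟩
  obtain ⟨a, ha, hνa⟩ := (isNormal_aleph.lt_iff_exists_lt (isSuccLimit_ord h)).1 hν
  exact ⟨e.symm (Ordinal.ToType.mk ⟨a, ha⟩), by simpa using hνa⟩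

theorem isCaliberStar_cubeSum {kap : Cardinal.{u}} (hinf : ℵ₀ ≤ kap)
    (hpow : (2 : Cardinal.{u}) ^ kap < ℵ_ kap.ord) (hcof : ℵ₀ < kap.ord.cof) :
    IsCaliberStar (CubeSum kap) (ℵ_ kap.ord) := by
  intro 𝒰 h𝒰 hcard
  have hlam := aleph0_le_aleph kap.ord
  set 𝒲 : Set (Set (CubeSum kap)) := {U ∈ 𝒰 | (Sum.inr ⁻¹' U).Nonempty}
  have hrest : #(𝒰 \ 𝒲 : Set (Set (CubeSum kap))) < ℵ_ kap.ord := by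
    refine lt_of_le_of_lt ?_ ((openCard_sigma_cantorCube_le hinf).trans_lt hpow)
    refine mk_le_of_injective (f := fun U : (𝒰 \ 𝒲 : Set (Set (CubeSum kap))) =>
      (⟨Sum.inl ⁻¹' U.1, (isOpen_sum_iff.1 (h𝒰 U U.2.1).1).1⟩ :
        {V : Set (Σ _ : kap.out, CantorCube kap) // IsOpen V})) fun U V h => Subtype.ext ?_
    have hempty : ∀ U : (𝒰 \ 𝒲 : Set (Set (CubeSum kap))), ∀ y, Sum.inr y ∉ U.1 :=
      fun U y hy => U.2.2 ⟨U.2.1, y, hy⟩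
    ext (x | y)
    · exact Set.ext_iff.1 (congrArg Subtype.val h) x
    · exact iff_of_false (hempty U y) (hempty V y)
  have h𝒲card : #𝒲 = ℵ_ kap.ord := by
    refine ((mk_le_mk_of_subset (Set.sep_subset _ _)).trans hcard.le).antisymm ?_
    by_contra! hlt
    have hsub : 𝒰 ⊆ 𝒲 ∪ 𝒰 \ 𝒲 := by rw [Set.union_sdiff_self]; exact Set.subset_union_right
    exact (hcard.ge.trans ((mk_le_mk_of_subset hsub).trans (mk_union_le _ _))).not_gt
      (add_lt_of_lt hlam hlt hrest)
  choose f hf using fun U : 𝒲 => U.2.2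
  choose F hF using fun U : 𝒲 =>
    exists_finset_of_isOpen_cube (isOpen_sum_iff.1 (h𝒰 U U.2.1).1).2 (hf U)
  obtain ⟨c, hclam, hc⟩ := exists_cofinal_cardinals hinf
  obtain ⟨J, hJ, g, hg⟩ := exists_common_extension (by rwa [mk_out])
    (by rw [mk_out]; exact (cantor kap).trans hpow) c hclam
    (fun ν hν => (hc ν hν).imp fun _ => le_of_lt)
    (by rwa [ord_aleph, Ordinal.cof_omega (isSuccLimit_ord hinf)]) F f h𝒲card
  refine ⟨Subtype.val '' J, ?_, by rw [mk_image_eq Subtype.val_injective, hJ], Sum.inr g, ?_⟩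
  · rintro _ ⟨U, _, rfl⟩
    exact U.2.1
  · rintro _ ⟨U, hU, rfl⟩
    exact hF U g (hg U hU)

/-- The copy of index `t` of the small Cantor cube. -/
def smallCube (kap : Cardinal.{u}) (t : kap.out) : Set (CubeSum kap) :=
  Set.range fun x => Sum.inl ⟨t, x⟩

theorem isOpen_smallCube (kap : Cardinal.{u}) (t : kap.out) : IsOpen (smallCube kap t) :=
  (Topology.IsOpenEmbedding.inl.comp Topology.IsOpenEmbedding.sigmaMk).isOpen_range

theorem smallCube_nonempty (kap : Cardinal.{u}) (t : kap.out) : (smallCube kap t).Nonempty :=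
  ⟨_, fun _ => false, rfl⟩

theorem eq_of_smallCube_inter_nonempty {kap : Cardinal.{u}} {s t : kap.out}
    (h : (smallCube kap s ∩ smallCube kap t).Nonempty) : s = t := by
  obtain ⟨_, ⟨x, rfl⟩, y, hy⟩ := h
  exact (congrArg Sigma.fst (Sum.inl.inj hy)).symm

theorem not_isWeakPrecaliber_cubeSum {kap : Cardinal.{u}} (hinf : ℵ₀ ≤ kap) :
    ¬ IsWeakPrecaliber (CubeSum kap) (ℵ_ kap.ord) := by
  intro hwp
  obtain ⟨c, hclam, hc⟩ := exists_cofinal_cardinals hinf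
  have hlam := aleph0_le_aleph kap.ord
  have hsum : #(Σ t, (c t).out) = ℵ_ kap.ord := by
    rw [mk_sigma]
    simp only [mk_out]
    refine le_antisymm ?_ ?_
    · refine (sum_le_mk_mul_iSup _).trans (mul_le_of_le hlam ?_ (ciSup_le' fun t => (hclam t).le))
      rw [mk_out]
      exact le_aleph_ord kap
    · by_contra! hlt
      obtain ⟨t, ht⟩ := hc _ hlt
      exact ht.not_ge (le_sum c t)
  obtain ⟨e⟩ : Nonempty ((ℵ_ kap.ord).out ≃ Σ t, (c t).out) :=
    Cardinal.eq.1 (by rw [mk_out, hsum])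
  obtain ⟨J, hJ, hlink⟩ := hwp (fun i => smallCube kap (e i).1) fun i =>
    ⟨isOpen_smallCube _ _, smallCube_nonempty _ _⟩
  have hne : J.Nonempty := by
    rw [Set.nonempty_iff_ne_empty, ne_eq, ← mk_set_eq_zero_iff, hJ]
    exact (aleph_pos _).ne'
  obtain ⟨j, hj⟩ := hne
  have hfst : ∀ i ∈ J, (e i).1 = (e j).1 := fun i hi =>
    eq_of_smallCube_inter_nonempty (hlink _ ⟨i, hi, rfl⟩ _ ⟨j, hj, rfl⟩)
  -- A linked `J` stays over one small cube, hence embeds in a single fibre, of size below `ℵ_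
  -- kap.ord`.
  have hle : #J ≤ #(Set.range fun a => (⟨(e j).1, a⟩ : Σ t, (c t).out)) := by
    refine mk_le_of_injective (f := fun i : J => ⟨e i.1, ?_⟩) fun i i' h => ?_
    · obtain ⟨i, hi⟩ := i
      have h := hfst i hi
      revert h
      generalize e i = q
      obtain ⟨t, a⟩ := q
      rintro rfl
      exact ⟨a, rfl⟩
    · exact Subtype.ext (e.injective (congrArg Subtype.val h))
  have := hle.trans mk_range_le
  rw [hJ, mk_out] at this
  exact this.not_gt (hclam _)

theorem not_isWeakPrecaliberStar_cubeSum {kap : Cardinal.{u}} (hinf : ℵ₀ ≤ kap) :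
    ¬ IsWeakPrecaliberStar (CubeSum kap) kap := by
  intro hwp
  have hinj : Function.Injective (smallCube kap) := fun s t h =>
    eq_of_smallCube_inter_nonempty (by rw [h, Set.inter_self]; exact smallCube_nonempty _ _)
  obtain ⟨𝒱, h𝒱, hcard, hlink⟩ := hwp (Set.range (smallCube kap)) (by
    rintro _ ⟨t, rfl⟩
    exact ⟨isOpen_smallCube _ _, smallCube_nonempty _ _⟩) (by rw [mk_range_eq _ hinj, mk_out])
  have hsub : 𝒱.Subsingleton := by
    intro U hU V hV
    obtain ⟨s, rfl⟩ := h𝒱 hU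
    obtain ⟨t, rfl⟩ := h𝒱 hV
    rw [eq_of_smallCube_inter_nonempty (hlink _ hU _ hV)]
  exact ((hcard.symm.le.trans (mk_le_one_iff_set_subsingleton.2 hsub)).trans_lt
    one_lt_aleph0).not_ge hinf

theorem mainTheorem2 (kap : Cardinal.{u}) (hinf : ℵ₀ ≤ kap)
    (hpow : (2 : Cardinal.{u}) ^ kap < ℵ_ kap.ord) (hcof : ℵ₀ < kap.ord.cof) :
    LocallyCompactSpace (CubeSum kap) ∧
    T4Space (CubeSum kap) ∧
    openCard (CubeSum kap) = (2 : Cardinal.{u}) ^ ℵ_ kap.ord ∧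
    #(CubeSum kap) = (2 : Cardinal.{u}) ^ ℵ_ kap.ord ∧
    ℵ_ kap.ord ∈ CStar (CubeSum kap) ∧
    ℵ_ kap.ord ∉ WP (CubeSum kap) ∧
    kap ∉ WPStar (CubeSum kap) := by
  exact ⟨locallyCompactSpace_cubeSum kap, t4Space_cubeSum kap, openCard_cubeSum hinf,
    mk_cubeSum kap, ⟨aleph0_le_aleph _, isCaliberStar_cubeSum hinf hpow hcof⟩,
    fun h => not_isWeakPrecaliber_cubeSum hinf h.2,
    fun h => not_isWeakPrecaliberStar_cubeSum hinf h.2⟩
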